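/- Let $\mathcal H$ be a complex Hilbert space, let $\mathcal B(\mathcal H)$ be the bounded linear operators on $\mathcal H$, and let $\mathcal P(\mathcal H)=\{P\in\mathcal B(\mathcal H): P=P^*=P^2\}$ be the set of orthogonal projections on $\mathcal H$, with the operator-norm topology. For self-adjoint operators $A,C$ write $A<C$ if $C-A$ is positive (i.e. positive semidefinite) and injective. Let $\lambda\in\mathbb R\setminus\{-1,0\}$ and let $T\in\mathcal B(\mathcal H)$ be a self-adjoint operator that is in generic position with respect to $\lambda$, that is, $$\ker T=\ker(T-I)=\ker(T-\lambda I)=\ker(T-(1+\lambda)I)=\{0\}.$$ Suppose that there are a complex Hilbert space $\mathcal K$ and a positive operator $B\in\mathcal B(\mathcal K)$ with $$\frac{|1-|\lambda||}{2}I<B<\frac{1+|\lambda|}{2}I$$ such that $T-\frac{1+\lambda}{2}I$ is unitarily equivalent to the operator $B\oplus(-B)$ on $\mathcal K\oplus\mathcal K$. Then $$\mathcal T_\lambda=\{(P,Q)\in\mathcal P(\mathcal H)\times\mathcal P(\mathcal H): T=\lambda P+Q\}$$ is a (nonempty) connected subset of $\mathcal P(\mathcal H)\times\mathcal P(\mathcal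 H)$. -/

import Mathlib

noncomputable section

namespace Pencil

/-- The set of orthogonal projections on `H` (self-adjoint idempotents of `B(H)`),
with the topology induced by the operator norm. -/
abbrev Projections (H : Type*) [NormedAddCommGroup H] [InnerProductSpace ℂ H]
    [CompleteSpace H] : Type _ :=
  {P : H →L[ℂ] H // IsStarProjection P}

/-- All pairs of orthogonal projections `(P, Q)` with `T = lam P + Q`. -/
def pencilPairs {H : Type*} [NormedAddCommGroup H] [InnerProductSpace ℂ H] [CompleteSpace H]
    (T : H →L[ℂ] H) (lam : ℝ) : Set (Projections H × Projections H) :=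
  {x | T = (lam : ℂ) • (x.1 : H →L[ℂ] H) + (x.2 : H →L[ℂ] H)}

/-- `0`, `1`, `lam` and `1 + lam` are not eigenvalues of `T`. -/
structure InGenericPosition {H : Type*} [NormedAddCommGroup H] [InnerProductSpace ℂ H]
    (T : H →L[ℂ] H) (lam : ℝ) : Prop where
  ker_zero : LinearMap.ker (T : H →ₗ[ℂ] H) = ⊥
  ker_one : LinearMap.ker ((T - 1 : H →L[ℂ] H) : H →ₗ[ℂ] H) = ⊥
  ker_lam : LinearMap.ker ((T - (lam : ℂ) • 1 : H →L[ℂ] H) : H →ₗ[ℂ] H) = ⊥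
  ker_one_add_lam : LinearMap.ker ((T - (1 + (lam : ℂ)) • 1 : H →L[ℂ] H) : H →ₗ[ℂ] H) = ⊥

/-- The strict order `A < B` on operators: `B - A` is positive and injective. -/
def StrictLT {K : Type*} [NormedAddCommGroup K] [InnerProductSpace ℂ K]
    (A B : K →L[ℂ] K) : Prop :=
  (B - A).IsPositive ∧ Function.Injective (B - A)

/-- The operator `A ⊕ B`, i.e. `(x, y) ↦ (A x, B y)`, on the Hilbert space sum `K ⊕ K`. -/
def directSum {K : Type*} [NormedAddCommGroup K] [InnerProductSpace ℂ K]
    (A B : K →L[ℂ] K) : WithLp 2 (K × K) →L[ℂ] WithLp 2 (K × K) :=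
  ((WithLp.prodContinuousLinearEquiv 2 ℂ K K).symm : K × K →L[ℂ] WithLp 2 (K × K)) ∘L
    (A.prodMap B) ∘L
    ((WithLp.prodContinuousLinearEquiv 2 ℂ K K) : WithLp 2 (K × K) →L[ℂ] K × K)

/-- `T - ((1 + lam) / 2) I` is `B ⊕ (-B)` under the identification `W` of `H` with `K ⊕ K`,
where `B` is positive and `(|1 - |lam|| / 2) I < B < ((1 + |lam|) / 2) I`. -/
structure HasSymmetricForm {H K : Type*}
    [NormedAddCommGroup H] [InnerProductSpace ℂ H]
    [NormedAddCommGroup K] [InnerProductSpace ℂ K]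
    (T : H →L[ℂ] H) (lam : ℝ) (B : K →L[ℂ] K) (W : H ≃ₗᵢ[ℂ] WithLp 2 (K × K)) : Prop where
  pos : B.IsPositive
  lower : StrictLT (((|1 - (|lam|)| / 2 : ℝ) : ℂ) • (1 : K →L[ℂ] K)) B
  upper : StrictLT B ((((1 + |lam|) / 2 : ℝ) : ℂ) • (1 : K →L[ℂ] K))
  form : ∀ x : H, W ((T - (((1 + lam) / 2 : ℝ) : ℂ) • (1 : H →L[ℂ] H)) x) =
    directSum B (-B) (W x)

end Pencil

end

namespace Pencil

open ContinuousLinearMap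

/-! ### Connectedness of the unitary group of a commutant. -/

section

variable {K : Type*} [NormedAddCommGroup K] [InnerProductSpace ℂ K] [CompleteSpace K]

/-! Pass to reflections: `U = 2P - 1` and `V = 2Q - 1` are self-adjoint involutions, and `T = λP +
Q` says `λU + V = S`, where `S = b ⊕ (-b)` and `b = 2B`. Given `U² = 1`, the condition `(S - λU)² =
1` becomes the linear equation `S² - λ(SU + US) + λ² - 1 = 0`.

In block form its diagonal part forces the entries `u, -u`, with `u = (b² + λ² - 1)/(2λb)`, because
only `0` anticommutes with an injective positive operator. Its off-diagonal part says that the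
corner `y` commutes with `b`. Then `U² = 1` leaves `y y* = y* y = 1 - u² = G²`. The strict bounds on
`B` make `G` injective, so `y = wG` for a unitary `w` commuting with `b`
(`exists_unitary_mul_eq_of_star_mul_self`). Conversely every such `w` yields a pair
(`involution_block_and_sub`).

So the set of pairs is a continuous image of the unitary group of the commutant of `b`. That group
is norm-connected because a commutant contains the spectral projections needed to split any unitary
into two factors close to `1` (`exists_unitary_mul_eq`). -/

lemma commute_starProjection_ker {A Z : K →L[ℂ] K} (hZ : Commute Z A) (hZ' : Commute (star Z) A) :
    Commute Z A.ker.starProjection := by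
  have key : ∀ Y : K →L[ℂ] K, Commute Y A →
      Y * A.ker.starProjection = A.ker.starProjection * (Y * A.ker.starProjection) := by
    intro Y hY
    ext x
    refine (Submodule.starProjection_eq_self_iff.mpr ?_).symm
    have hx : A (A.ker.starProjection x) = 0 := A.ker.starProjection_apply_mem x
    have h := congr($(hY.eq) (A.ker.starProjection x))
    change Y (A (A.ker.starProjection x)) = A (Y (A.ker.starProjection x)) at h
    rw [hx, map_zero] at h
    exact h.symm
  have hF : star A.ker.starProjection = A.ker.starProjection :=
    isSelfAdjoint_starProjection A.ker
  have h1 := key Z hZ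
  have h2 := congr(star $(key _ hZ'))
  simp only [star_mul, star_star, hF] at h2
  rw [Commute, SemiconjBy, h1, h2, mul_assoc]

/-- `‖v - 1‖² = ‖2 - (v + v*)‖ ≤ 2`. Distance less than 2 is what joins two unitaries by a path. -/
lemma norm_sub_one_lt_two_of_nonneg_add_star {A : Type*} [CStarAlgebra A] [PartialOrder A]
    [StarOrderedRing A] {v : A} (hv : v ∈ unitary A) (h : 0 ≤ v + star v) : ‖v - 1‖ < 2 := by
  have h1 : star (v - 1) * (v - 1) = 2 - (v + star v) := by
    have := (Unitary.mem_iff.mp hv).1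
    simp only [star_sub, star_one, sub_mul, mul_sub, this]
    rw [← one_add_one_eq_two]; noncomm_ring
  have h2 : ‖star (v - 1) * (v - 1)‖ ≤ 2 := by
    rw [CStarAlgebra.norm_le_iff_le_algebraMap _ zero_le_two (star_mul_self_nonneg _), h1]
    rw [map_ofNat]
    exact sub_le_self _ h
  rw [CStarRing.norm_star_mul_self] at h2
  nlinarith [norm_nonneg (v - 1)]

/-- Split the spectrum of `w` into upper and lower half circles, with `F` projecting onto the part
where `Im w ≤ 0`. Turning the upper half by `-i` and the lower half by `i` moves each into the
closed right half plane. The remaining constants `-i` and `i` lie on its boundary and make the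
product equal to `w`. -/
lemma exists_unitary_mul_eq {w : K →L[ℂ] K} (hw : w ∈ unitary (K →L[ℂ] K)) :
    ∃ F : K →L[ℂ] K, ∃ v₁ ∈ unitary (K →L[ℂ] K), ∃ v₂ ∈ unitary (K →L[ℂ] K),
      (∀ Z : K →L[ℂ] K, Commute Z w → Commute (star Z) w → Commute Z F) ∧
      v₁ = (-Complex.I) • (w * (1 - F) + F) ∧ v₂ = Complex.I • ((1 - F) + w * F) ∧
      v₁ * v₂ = w ∧ ‖v₁ - 1‖ < 2 ∧ ‖v₂ - 1‖ < 2 := by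
  obtain ⟨hw1, hw2⟩ := Unitary.mem_iff.mp hw
  -- This is twice the imaginary part of `w`.
  set h : K →L[ℂ] K := Complex.I • (star w - w) with hh
  have hsa : IsSelfAdjoint h := by
    rw [IsSelfAdjoint, hh, star_smul]
    simp [smul_sub]
    abel
  have hZh : ∀ Z : K →L[ℂ] K, Commute Z w → Commute (star Z) w → Commute Z h⁺ := by
    intro Z h1 h2
    have h3 : Commute Z (star w) := by simpa using h2.star_star
    exact (Commute.cfcₙ_real ((h3.sub_right h1).smul_right Complex.I).symm _).symm
  set F := (h⁺ : K →L[ℂ] K).ker.starProjection with hF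
  have hZF : ∀ Z : K →L[ℂ] K, Commute Z w → Commute (star Z) w → Commute Z F := by
    intro Z h1 h2
    refine commute_starProjection_ker (hZh Z h1 h2) (hZh _ h2 (by simpa using h1))
  have hFp : IsStarProjection F := isStarProjection_starProjection
  have hFF : F * F = F := hFp.1
  have hFs : star F = F := hFp.2
  have hwF : w * F = F * w := hZF w rfl (by rw [Commute, SemiconjBy, hw1, hw2])
  have hwF' : star w * F = F * star w := by
    have := congr(star $hwF)
    simpa [hFs] using this.symm
  have hpF : h⁺ * F = 0 := by
    ext x
    exact (h⁺ : K →L[ℂ] K).ker.starProjection_apply_mem x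
  have hFn : F * h⁻ = h⁻ := by
    ext x
    refine Submodule.starProjection_eq_self_iff.mpr ?_
    have := congr($(CFC.posPart_mul_negPart h) x)
    exact this
  have hnF : h⁻ * F = h⁻ := by
    have := congr(star $hFn)
    rwa [star_mul, hFs, (CFC.negPart_nonneg h).isSelfAdjoint.star_eq] at this
  have hhF : h * F = - h⁻ := by
    conv_lhs => rw [← CFC.posPart_sub_negPart h, sub_mul, hpF, hnF, zero_sub]
  have hhF' : h * (1 - F) = h⁺ := by
    rw [mul_sub, hhF, mul_one, sub_neg_eq_add]
    nth_rewrite 1 [← CFC.posPart_sub_negPart h]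
    exact sub_add_cancel _ _
  have r1 : ∀ x, F * (F * x) = F * x := fun x ↦ by rw [← mul_assoc, hFF]
  have r2 : ∀ x, w * (F * x) = F * (w * x) := fun x ↦ by rw [← mul_assoc, hwF, mul_assoc]
  have r3 : ∀ x, star w * (F * x) = F * (star w * x) := fun x ↦ by
    rw [← mul_assoc, hwF', mul_assoc]
  have hv1 : (-Complex.I) • (w * (1 - F) + F) ∈ unitary (K →L[ℂ] K) := by
    rw [Unitary.mem_iff]
    constructor <;>
    · simp only [star_smul, star_add, star_mul, star_sub, hFs, smul_mul_smul_comm,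
        mul_add, add_mul, mul_sub, sub_mul, mul_assoc, r1, r2, r3, hFF, hwF, hwF', hw1, hw2,
        mul_one]
      simp
  have hv2 : Complex.I • ((1 - F) + w * F) ∈ unitary (K →L[ℂ] K) := by
    rw [Unitary.mem_iff]
    constructor <;>
    · simp only [star_smul, star_add, star_mul, star_sub, star_one, hFs, smul_mul_smul_comm,
        mul_add, add_mul, mul_sub, sub_mul, mul_assoc, r1, r2, r3, hFF, hwF, hwF', hw1, hw2,
        mul_one, one_mul]
      simp
  refine ⟨F, _, hv1, _, hv2, hZF, rfl, rfl, ?_, norm_sub_one_lt_two_of_nonneg_add_star hv1 ?_,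
    norm_sub_one_lt_two_of_nonneg_add_star hv2 ?_⟩
  · simp only [smul_mul_smul_comm, mul_add, add_mul, mul_sub, sub_mul, mul_assoc, r1, r2, hFF,
      hwF, mul_one]
    simp
  · have : (-Complex.I) • (w * (1 - F) + F) + star ((-Complex.I) • (w * (1 - F) + F)) = h⁺ := by
      rw [← hhF', hh]
      simp only [star_smul, star_add, star_mul, star_sub, hFs, mul_sub, sub_mul, smul_mul_assoc,
        hwF, hwF', mul_one, smul_sub, smul_add]
      simp
      abel
    rw [this]
    exact CFC.posPart_nonneg h
  · have : Complex.I • ((1 - F) + w * F) + star (Complex.I • ((1 - F) + w * F)) = h⁻ := by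
      rw [← neg_neg (h⁻), ← hhF, hh]
      simp only [star_smul, star_add, star_mul, star_sub, star_one, hFs, sub_mul, smul_mul_assoc,
        hwF, hwF', smul_sub, smul_add]
      simp
      abel
    rw [this]
    exact CFC.negPart_nonneg h

/-- The commutant of a self-adjoint operator. -/
noncomputable abbrev commutant (b : K →L[ℂ] K) : StarSubalgebra ℂ (K →L[ℂ] K) :=
  StarSubalgebra.centralizer ℂ {b}

lemma mem_commutant {b : K →L[ℂ] K} (hb : IsSelfAdjoint b) {z : K →L[ℂ] K} :
    z ∈ commutant b ↔ Commute z b := by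
  simp [StarSubalgebra.mem_centralizer_iff, hb.star_eq, Commute, SemiconjBy, eq_comm]

instance isClosed_commutant (b : K →L[ℂ] K) : IsClosed (commutant b : Set (K →L[ℂ] K)) := by
  rw [StarSubalgebra.coe_centralizer]
  exact Set.isClosed_centralizer _

theorem connectedSpace_unitary_commutant {b : K →L[ℂ] K} (hb : IsSelfAdjoint b) :
    ConnectedSpace (unitary (commutant b)) := by
  have key : ∀ w : unitary (commutant b), Joined 1 w := by
    intro w
    have hw : ((w : commutant b) : K →L[ℂ] K) ∈ unitary (K →L[ℂ] K) := by
      have := Unitary.mem_iff.mp w.2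
      exact Unitary.mem_iff.mpr ⟨congr(Subtype.val $(this.1)), congr(Subtype.val $(this.2))⟩
    obtain ⟨F, v₁, hv₁, v₂, hv₂, hF, e₁, e₂, hmul, hn₁, hn₂⟩ := exists_unitary_mul_eq hw
    have hwc : Commute b (w : commutant b) := ((mem_commutant hb).mp w.1.2).symm
    have hFc : F ∈ commutant b := (mem_commutant hb).mpr
      (hF b hwc (by rwa [hb.star_eq])).symm
    have h₁ : v₁ ∈ commutant b := e₁ ▸ (commutant b).smul_mem
      (add_mem (mul_mem w.1.2 (sub_mem (one_mem _) hFc)) hFc) _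
    have h₂ : v₂ ∈ commutant b := e₂ ▸ (commutant b).smul_mem
      (add_mem (sub_mem (one_mem _) hFc) (mul_mem w.1.2 hFc)) _
    have lift : ∀ v (hv : v ∈ unitary (K →L[ℂ] K)) (h : v ∈ commutant b),
        (⟨v, h⟩ : commutant b) ∈ unitary (commutant b) := fun v hv h ↦ by
      have := Unitary.mem_iff.mp hv
      exact Unitary.mem_iff.mpr ⟨Subtype.ext this.1, Subtype.ext this.2⟩
    let u₁ : unitary (commutant b) := ⟨⟨v₁, h₁⟩, lift v₁ hv₁ h₁⟩
    have j₁ : Joined 1 u₁ := Unitary.joined 1 u₁ hn₁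
    refine j₁.trans (Unitary.joined u₁ w ?_)
    change ‖((w : commutant b) : K →L[ℂ] K) - v₁‖ < 2
    rw [← hmul, ← mul_sub_one, CStarRing.norm_mem_unitary_mul _ hv₁]
    exact hn₂
  have : PathConnectedSpace (unitary (commutant b)) :=
    ⟨⟨1⟩, fun x y ↦ (key x).symm.trans (key y)⟩
  infer_instance

end

/-! ### Polar factors and the functions of `b` that fill the blocks. -/

section

variable {K : Type*} [NormedAddCommGroup K] [InnerProductSpace ℂ K]

lemma eq_of_mul_right_eq {G A B : K →L[ℂ] K} (hG : DenseRange G) (h : A * G = B * G) : A = B :=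
  DFunLike.coe_injective (hG.equalizer A.continuous B.continuous
    (funext fun x ↦ congr($h x)))

lemma eq_of_mul_left_eq {G A B : K →L[ℂ] K} (hG : Function.Injective G) (h : G * A = G * B) :
    A = B :=
  ContinuousLinearMap.ext fun x ↦ hG congr($h x)

lemma injective_of_isUnit {b : K →L[ℂ] K} (hb : IsUnit b) : Function.Injective b := by
  obtain ⟨u, rfl⟩ := hb
  intro x y hxy
  have := congr(((↑u⁻¹ : K →L[ℂ] K)) $hxy)
  simpa [← mul_apply_eq_comp] using! this

variable [CompleteSpace K]

lemma denseRange_of_isSelfAdjoint {G : K →L[ℂ] K} (hG : IsSelfAdjoint G)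
    (hinj : Function.Injective G) : DenseRange G := by
  have h : G.range.topologicalClosure = ⊤ := by
    rw [Submodule.topologicalClosure_eq_top_iff, G.orthogonal_range, ← star_eq_adjoint, hG.star_eq]
    exact LinearMap.ker_eq_bot.mpr hinj
  have := (Submodule.dense_iff_topologicalClosure_eq_top).mpr h
  exact this

/-- Since `‖y x‖ = ‖G x‖`, the map `G x ↦ y x` extends from the dense range of `G`. The identities
for `w` follow by cancelling `G` on the left (injective) or on the right (dense range). -/
lemma exists_unitary_mul_eq_of_star_mul_self {y G b : K →L[ℂ] K} (hG : IsSelfAdjoint G)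
    (hinj : Function.Injective G) (hy : star y * y = G * G) (hy' : y * star y = G * G)
    (hyG : Commute y G) (hyb : Commute y b) (hGb : Commute G b) :
    ∃ w ∈ unitary (K →L[ℂ] K), w * G = y ∧ Commute w b := by
  have hd := denseRange_of_isSelfAdjoint hG hinj
  have hnorm : ∀ x, ‖(y : K →ₗ[ℂ] K) x‖ ≤ 1 * ‖(G : K →ₗ[ℂ] K) x‖ := by
    intro x
    have h1 : inner ℂ (y x) (y x) = inner ℂ (G x) (G x) := by
      have e1 : inner ℂ x ((star y * y) x) = inner ℂ (y x) (y x) := by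
        rw [star_eq_adjoint]; exact adjoint_inner_right y x (y x)
      have e2 : inner ℂ x ((star G * G) x) = inner ℂ (G x) (G x) := by
        rw [star_eq_adjoint]; exact adjoint_inner_right G x (G x)
      rw [← e1, ← e2, hy, hG.star_eq]
    rw [inner_self_eq_norm_sq_to_K, inner_self_eq_norm_sq_to_K] at h1
    have h2 : ‖y x‖ ^ 2 = ‖G x‖ ^ 2 := by exact_mod_cast h1
    rw [one_mul]
    exact ((sq_eq_sq₀ (norm_nonneg _) (norm_nonneg _)).mp h2).le
  set w := (y : K →ₗ[ℂ] K).extendOfNorm (G : K →ₗ[ℂ] K)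
  have hw : w * G = y := ContinuousLinearMap.ext fun x ↦
    LinearMap.extendOfNorm_eq (f := (y : K →ₗ[ℂ] K)) (e := (G : K →ₗ[ℂ] K)) hd ⟨1, hnorm⟩ x
  have hw' : G * star w = star y := by rw [← hw, star_mul, hG.star_eq]
  have hwG : w * G = G * w := eq_of_mul_right_eq hd <| by
    rw [hw, hyG.eq, mul_assoc, hw]
  have hwb : Commute w b := eq_of_mul_right_eq hd <| by
    rw [mul_assoc, ← hGb.eq, ← mul_assoc, hw, hyb.eq, ← hw, mul_assoc]
  refine ⟨w, Unitary.mem_iff.mpr ⟨?_, ?_⟩, hw, hwb⟩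
  · refine eq_of_mul_left_eq hinj (eq_of_mul_right_eq hd ?_)
    rw [← mul_assoc, hw', mul_assoc, hw, hy, mul_one]
  · refine eq_of_mul_left_eq hinj (eq_of_mul_right_eq hd ?_)
    have hwG' : star w * G = G * star w := by
      have := congr(star $hwG)
      simpa [hG.star_eq] using this.symm
    rw [← mul_assoc, ← hwG, hw, mul_assoc, hwG', hw', hy', mul_one]

/-- `4l²s² - (s² + l² - 1)² = (s² - (1 - |l|)²)((1 + |l|)² - s²)`, and both factors are nonnegative.
-/
lemma pencil_symbol_sq_le {l s : ℝ} (hl : l ≠ 0) (h1 : |1 - (|l|)| ≤ s)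
    (h2 : s ≤ 1 + |l|) : ((s ^ 2 + l ^ 2 - 1) / (2 * l * s)) ^ 2 ≤ 1 := by
  rcases eq_or_ne s 0 with rfl | hs
  · simp
  have hs0 : 0 ≤ s := (abs_nonneg _).trans h1
  rw [div_pow, div_le_one (by positivity)]
  have hl2 : l ^ 2 = |l| ^ 2 := (sq_abs l).symm
  rw [mul_pow, mul_pow, hl2]
  obtain ⟨h3, h4⟩ := abs_le.mp h1
  have := abs_pos.mpr hl
  nlinarith [mul_nonneg (mul_nonneg (sub_nonneg.mpr h4) (by linarith : 0 ≤ s + (1 - |l|)))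
    (mul_nonneg (sub_nonneg.mpr h2) (by linarith : 0 ≤ 1 + |l| + s))]

lemma isUnit_add_algebraMap {b : K →L[ℂ] K} (hb : 0 ≤ b) {r : ℝ} (hr : 0 < r) :
    IsUnit (b + algebraMap ℝ (K →L[ℂ] K) r) :=
  CStarAlgebra.isUnit_of_le (algebraMap ℝ (K →L[ℂ] K) r) (le_add_of_nonneg_left hb)
    (IsStrictlyPositive.iff_of_unital.mpr
      ⟨algebraMap_nonneg _ hr.le, (IsUnit.mk0 r hr.ne').map (algebraMap ℝ (K →L[ℂ] K))⟩)

theorem exists_pencil_symbols {b : K →L[ℂ] K} {l : ℝ} (hl0 : l ≠ 0) (hl1 : l ≠ -1)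
    (hb : 0 ≤ b)
    (hlow : algebraMap ℝ (K →L[ℂ] K) |1 - (|l|)| ≤ b)
    (hlow_inj : Function.Injective (b - algebraMap ℝ (K →L[ℂ] K) |1 - (|l|)|))
    (hup : b ≤ algebraMap ℝ (K →L[ℂ] K) (1 + |l|))
    (hup_inj : Function.Injective (algebraMap ℝ (K →L[ℂ] K) (1 + |l|) - b)) :
    Function.Injective b ∧ ∃ u G : K →L[ℂ] K, IsSelfAdjoint u ∧ IsSelfAdjoint G ∧
      (2 * l) • (b * u) = b * b + (l ^ 2 - 1) • 1 ∧ u * u + G * G = 1 ∧ Function.Injective G ∧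
      (∀ z, Commute z b → Commute z u) ∧ ∀ z, Commute z b → Commute z G := by
  have hsa : IsSelfAdjoint b := hb.isSelfAdjoint
  set m := |1 - (|l|)| with hm
  have hm0 : 0 ≤ m := abs_nonneg _
  have hspec : ∀ s ∈ spectrum ℝ b, m ≤ s ∧ s ≤ 1 + |l| := fun s hs ↦
    ⟨(algebraMap_le_iff_le_spectrum (a := b)).mp hlow s hs,
      (le_algebraMap_iff_spectrum_le (a := b)).mp hup s hs⟩
  set f : ℝ → ℝ := fun s ↦ (s ^ 2 + l ^ 2 - 1) / (2 * l * s) with hf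
  have hmcase : m = 0 → l = 1 := by
    intro h
    have h1 : |l| = 1 := by
      have := abs_eq_zero.mp h
      linarith
    rcases abs_eq (by norm_num : (0 : ℝ) ≤ 1) |>.mp h1 with h | h
    · exact h
    · exact absurd h hl1
  have hfc : ContinuousOn f (spectrum ℝ b) := by
    rcases hm0.eq_or_lt with h | h
    · have h1 := hmcase h.symm
      -- For `l = 1` the singularity at `0` is removable, and division by zero returns the right
      -- value `0`.
      have : f = fun s ↦ s / 2 := by
        funext s
        rcases eq_or_ne s 0 with rfl | hs
        · simp [hf]
        · simp only [hf, h1]; field_simp; ring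
      rw [this]; fun_prop
    · refine ContinuousOn.div (by fun_prop) (by fun_prop) fun s hs ↦ ?_
      have := (hspec s hs).1
      have : s ≠ 0 := (h.trans_le this).ne'
      positivity
  have hfle : ∀ s ∈ spectrum ℝ b, f s ^ 2 ≤ 1 := fun s hs ↦
    pencil_symbol_sq_le hl0 (hspec s hs).1 (hspec s hs).2
  set g : ℝ → ℝ := fun s ↦ Real.sqrt (1 - f s ^ 2) with hg
  have hgc : ContinuousOn g (spectrum ℝ b) := by fun_prop
  have hsf : ∀ s ∈ spectrum ℝ b, 2 * l * (s * f s) = s * s + (l ^ 2 - 1) := by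
    intro s hs
    rcases eq_or_ne s 0 with rfl | hs0
    · have := hmcase (le_antisymm (hspec 0 hs).1 hm0)
      simp [this]
    · simp only [hf]; field_simp; ring
  have hsg : ∀ s ∈ spectrum ℝ b, f s * f s + g s * g s = 1 := by
    intro s hs
    rw [hg, Real.mul_self_sqrt (by linarith [hfle s hs])]
    ring
  have hbinj : Function.Injective b := by
    rcases hm0.eq_or_lt with h | h
    · simpa [← h] using hlow_inj
    · have := isUnit_add_algebraMap (sub_nonneg.mpr hlow) h
      rw [sub_add_cancel] at this
      exact injective_of_isUnit this
  have hbm : Function.Injective (b + algebraMap ℝ (K →L[ℂ] K) m) := by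
    rcases hm0.eq_or_lt with h | h
    · simpa [← h] using hbinj
    · exact injective_of_isUnit (isUnit_add_algebraMap hb h)
  have hbl : Function.Injective (b + algebraMap ℝ (K →L[ℂ] K) (1 + |l|)) :=
    injective_of_isUnit (isUnit_add_algebraMap hb (by positivity))
  have hid : cfc (fun s : ℝ ↦ s) b = b := cfc_id' ℝ b
  have hffgg : cfc f b * cfc f b + cfc g b * cfc g b = 1 := by
    rw [← cfc_mul f f b, ← cfc_mul g g b, ← cfc_add b _ _, cfc_congr hsg, cfc_const_one ℝ b]
  -- Each of the four factors on the right is injective, by the strict bounds or by invertibility,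
  -- so `G` is injective.
  have hprod : (4 * l ^ 2) • (b * b * (cfc g b * cfc g b)) =
      (b - algebraMap ℝ (K →L[ℂ] K) m) * (b + algebraMap ℝ (K →L[ℂ] K) m) *
      ((algebraMap ℝ (K →L[ℂ] K) (1 + |l|) - b) * (b + algebraMap ℝ (K →L[ℂ] K) (1 + |l|))) := by
    have hadd : ∀ r : ℝ, cfc (fun s : ℝ ↦ s + r) b = b + algebraMap ℝ (K →L[ℂ] K) r := fun r ↦ by
      rw [cfc_add_const r (fun s ↦ s) b, hid]
    have hsub : ∀ r : ℝ, cfc (fun s : ℝ ↦ r - s) b = algebraMap ℝ (K →L[ℂ] K) r - b := fun r ↦ by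
      rw [cfc_sub (fun _ ↦ r) (fun s ↦ s) b, hid, cfc_const r b]
    have hL : cfc (fun s ↦ (4 * l ^ 2) • (s * s * (g s * g s))) b =
        (4 * l ^ 2) • (b * b * (cfc g b * cfc g b)) := by
      rw [cfc_smul (4 * l ^ 2) (fun s ↦ s * s * (g s * g s)) b,
        cfc_mul (fun s ↦ s * s) (fun s ↦ g s * g s) b, cfc_mul (fun s ↦ s) (fun s ↦ s) b,
        cfc_mul g g b, hid]
    have hR : cfc (fun s ↦ (s + -m) * (s + m) * ((1 + |l| - s) * (s + (1 + |l|)))) b =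
        (b - algebraMap ℝ (K →L[ℂ] K) m) * (b + algebraMap ℝ (K →L[ℂ] K) m) *
        ((algebraMap ℝ (K →L[ℂ] K) (1 + |l|) - b) *
          (b + algebraMap ℝ (K →L[ℂ] K) (1 + |l|))) := by
      rw [cfc_mul (fun s ↦ (s + -m) * (s + m)) (fun s ↦ (1 + |l| - s) * (s + (1 + |l|))) b,
        cfc_mul (fun s ↦ s + -m) (fun s ↦ s + m) b,
        cfc_mul (fun s ↦ 1 + |l| - s) (fun s ↦ s + (1 + |l|)) b, hadd, hadd, hadd, hsub,
        map_neg, ← sub_eq_add_neg]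
    rw [← hL, ← hR]
    refine cfc_congr fun s hs ↦ ?_
    have h1 := hsf s hs
    have h2 : g s * g s = 1 - f s * f s := by linarith [hsg s hs]
    have h3 : m ^ 2 = (1 - |l|) ^ 2 := sq_abs _
    have h4 : |l| ^ 2 = l ^ 2 := sq_abs _
    simp only [smul_eq_mul, h2]
    have h5 : 4 * l ^ 2 * (s * s * (1 - f s * f s)) =
        4 * l ^ 2 * s ^ 2 - (s * s + (l ^ 2 - 1)) ^ 2 := by
      rw [← h1]; ring
    have h6 : (s + -m) * (s + m) * ((1 + |l| - s) * (s + (1 + |l|))) =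
        (s ^ 2 - m ^ 2) * ((1 + |l|) ^ 2 - s ^ 2) := by ring
    rw [h5, h6, h3, ← h4]
    ring
  refine ⟨hbinj, cfc f b, cfc g b, cfc_predicate f b, cfc_predicate g b, ?_, hffgg, ?_, ?_, ?_⟩
  · have hL : cfc (fun s ↦ (2 * l) • (s * f s)) b = (2 * l) • (b * cfc f b) := by
      rw [cfc_smul (2 * l) (fun s ↦ s * f s) b, cfc_mul (fun s ↦ s) f b, hid]
    have hR : cfc (fun s ↦ s * s + (l ^ 2 - 1)) b = b * b + (l ^ 2 - 1) • 1 := by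
      rw [cfc_add_const (l ^ 2 - 1) (fun s ↦ s * s) b, cfc_mul (fun s ↦ s) (fun s ↦ s) b, hid,
        Algebra.algebraMap_eq_smul_one]
    rw [← hL, ← hR]
    exact cfc_congr hsf
  · have h1 : Function.Injective
        ((4 * l ^ 2) • (b * b * (cfc g b * cfc g b)) : K →L[ℂ] K) := by
      rw [hprod]
      exact (hlow_inj.comp hbm).comp (hup_inj.comp hbl)
    intro x y hxy
    apply h1
    simp [mul_apply_eq_comp, hxy]
  · exact fun z hz ↦ (hz.symm.cfc_real f).symm
  · exact fun z hz ↦ (hz.symm.cfc_real g).symm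

end

/-! ### Two-by-two block operators and involutions. -/

section

variable {H K : Type*} [NormedAddCommGroup H] [InnerProductSpace ℂ H]
    [NormedAddCommGroup K] [InnerProductSpace ℂ K]
    (W : H ≃ₗᵢ[ℂ] WithLp 2 (K × K))

/-- The operator on `H` with block matrix `(p, q; r, s)` under the identification `W` of `H` with
`K ⊕ K`. -/
noncomputable def block (p q r s : K →L[ℂ] K) : H →L[ℂ] H :=
  let e := (W.toContinuousLinearEquiv.trans (WithLp.prodContinuousLinearEquiv 2 ℂ K K))
  let p₁ : H →L[ℂ] K := fst ℂ K K ∘L (e : H →L[ℂ] K × K)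
  let p₂ : H →L[ℂ] K := snd ℂ K K ∘L (e : H →L[ℂ] K × K)
  let i₁ : K →L[ℂ] H := (e.symm : K × K →L[ℂ] H) ∘L inl ℂ K K
  let i₂ : K →L[ℂ] H := (e.symm : K × K →L[ℂ] H) ∘L inr ℂ K K
  i₁ ∘L p ∘L p₁ + i₁ ∘L q ∘L p₂ + i₂ ∘L r ∘L p₁ + i₂ ∘L s ∘L p₂

variable {W}

lemma apply_block (p q r s : K →L[ℂ] K) (x : H) :
    W (block W p q r s x) =
      WithLp.toLp 2 (p (W x).fst + q (W x).snd, r (W x).fst + s (W x).snd) := by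
  apply WithLp.ofLp_injective
  simp [block]

lemma block_ext {A B : H →L[ℂ] H} (h : ∀ x, W (A x) = W (B x)) : A = B :=
  ContinuousLinearMap.ext fun x ↦ W.injective (h x)

lemma block_mul (p q r s p' q' r' s' : K →L[ℂ] K) :
    block W p q r s * block W p' q' r' s' =
      block W (p * p' + q * r') (p * q' + q * s') (r * p' + s * r') (r * q' + s * s') := by
  refine block_ext (W := W) fun x ↦ ?_
  simp only [mul_apply_eq_comp, apply_block, add_apply, map_add, WithLp.toLp_fst, WithLp.toLp_snd]
  congr 2 <;> abel

lemma block_add (p q r s p' q' r' s' : K →L[ℂ] K) :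
    block W p q r s + block W p' q' r' s' = block W (p + p') (q + q') (r + r') (s + s') := by
  simp only [block, add_comp, comp_add]
  abel

lemma block_sub (p q r s p' q' r' s' : K →L[ℂ] K) :
    block W p q r s - block W p' q' r' s' = block W (p - p') (q - q') (r - r') (s - s') := by
  simp only [block, sub_comp, comp_sub]
  abel

lemma block_smul (c : ℂ) (p q r s : K →L[ℂ] K) :
    c • block W p q r s = block W (c • p) (c • q) (c • r) (c • s) := by
  simp [block]

lemma block_one : block W 1 0 0 1 = 1 := by
  refine block_ext (W := W) fun x ↦ ?_
  apply WithLp.ofLp_injective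
  simp [apply_block]
  rfl

lemma block_inj {p q r s p' q' r' s' : K →L[ℂ] K} :
    block W p q r s = block W p' q' r' s' ↔ p = p' ∧ q = q' ∧ r = r' ∧ s = s' := by
  refine ⟨fun h ↦ ?_, by rintro ⟨rfl, rfl, rfl, rfl⟩; rfl⟩
  have key : ∀ x y : K, p x + q y = p' x + q' y ∧ r x + s y = r' x + s' y := by
    intro x y
    have h1 := congr(WithLp.ofLp (W ($h (W.symm (WithLp.toLp 2 (x, y))))))
    simpa [apply_block] using h1
  refine ⟨?_, ?_, ?_, ?_⟩ <;> ext x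
  · simpa using (key x 0).1
  · simpa using (key 0 x).1
  · simpa using (key x 0).2
  · simpa using (key 0 x).2

lemma exists_eq_block (X : H →L[ℂ] H) : ∃ p q r s : K →L[ℂ] K, X = block W p q r s := by
  let e := (W.toContinuousLinearEquiv.trans (WithLp.prodContinuousLinearEquiv 2 ℂ K K))
  let Y : K × K →L[ℂ] K × K := (e : H →L[ℂ] K × K) ∘L X ∘L (e.symm : K × K →L[ℂ] H)
  refine ⟨fst ℂ K K ∘L Y ∘L inl ℂ K K, fst ℂ K K ∘L Y ∘L inr ℂ K K,
    snd ℂ K K ∘L Y ∘L inl ℂ K K, snd ℂ K K ∘L Y ∘L inr ℂ K K, block_ext (W := W) fun x ↦ ?_⟩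
  have h : ∀ z : K × K, Y z = Y (z.1, 0) + Y (0, z.2) := fun z ↦ by
    rw [← map_add]; simp
  have hx : Y (e x) = WithLp.ofLp (W (X x)) := by simp [Y, e]
  apply WithLp.ofLp_injective
  rw [← hx, h]
  simp [apply_block, e]
  rfl

lemma continuous_block {X : Type*} [TopologicalSpace X] {p q r s : X → K →L[ℂ] K}
    (hp : Continuous p) (hq : Continuous q) (hr : Continuous r) (hs : Continuous s) :
    Continuous fun x ↦ block W (p x) (q x) (r x) (s x) := by
  unfold block
  fun_prop

variable [CompleteSpace H] [CompleteSpace K]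

lemma star_block (p q r s : K →L[ℂ] K) :
    star (block W p q r s) = block W (star p) (star r) (star q) (star s) := by
  symm
  rw [star_eq_adjoint (block W p q r s), eq_adjoint_iff]
  intro x y
  rw [← W.inner_map_map, ← W.inner_map_map x, apply_block, apply_block]
  simp only [WithLp.prod_inner_apply, inner_add_left, inner_add_right, star_eq_adjoint,
    adjoint_inner_left, WithLp.ofLp_fst, WithLp.ofLp_snd]
  ring

lemma isSelfAdjoint_block {p y : K →L[ℂ] K} (hp : IsSelfAdjoint p) :
    IsSelfAdjoint (block W p y (star y) (-p)) := by
  rw [IsSelfAdjoint, star_block, star_neg, star_star, hp.star_eq]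

omit [CompleteSpace H] in
lemma block_mul_self {p y : K →L[ℂ] K} (hpy : Commute y p) (hpy' : Commute (star y) p)
    (h1 : p * p + y * star y = 1) (h2 : p * p + star y * y = 1) :
    block W p y (star y) (-p) * block W p y (star y) (-p) = 1 := by
  rw [block_mul, ← block_one (W := W), block_inj]
  refine ⟨h1, ?_, ?_, ?_⟩
  · rw [mul_neg, hpy.eq, add_neg_cancel]
  · rw [neg_mul, hpy'.eq, add_neg_cancel]
  · rw [neg_mul_neg, add_comm, h2]

lemma isStarProjection_of_involution {U : H →L[ℂ] H} (hU : IsSelfAdjoint U) (h : U * U = 1) :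
    IsStarProjection ((1 / 2 : ℂ) • (1 + U)) := by
  refine ⟨?_, ?_⟩
  · simp only [IsIdempotentElem, smul_mul_smul_comm, mul_add, add_mul, h, mul_one, one_mul]
    module
  · rw [IsSelfAdjoint, star_smul, star_add, star_one, hU.star_eq]
    simp

lemma involution_of_isStarProjection {P : H →L[ℂ] H} (hP : IsStarProjection P) :
    IsSelfAdjoint ((2 : ℂ) • P - 1) ∧ ((2 : ℂ) • P - 1) * ((2 : ℂ) • P - 1) = 1 := by
  refine ⟨?_, ?_⟩
  · rw [IsSelfAdjoint, star_sub, star_smul, star_one, hP.2.star_eq]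
    simp
  · have h : P * P = P := hP.1
    rw [sub_mul, mul_sub, smul_mul_smul_comm, h, mul_one, one_mul]
    module

/-- Anticommuting with `b` implies commuting with `b²`, hence with `b = √(b²)`. Then `2ba = 0`. -/
lemma eq_zero_of_anticommute {a b : K →L[ℂ] K} (hb : 0 ≤ b) (hinj : Function.Injective b)
    (h : b * a + a * b = 0) : a = 0 := by
  have h1 : b * a = -(a * b) := eq_neg_of_add_eq_zero_left h
  have h2 : Commute (b * b) a := by
    rw [Commute, SemiconjBy, mul_assoc, h1, mul_neg, ← mul_assoc, h1, neg_mul, neg_neg, mul_assoc]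
  have h3 : Commute b a := by
    have := h2.cfcₙ_nnreal NNReal.sqrt
    change Commute (CFC.sqrt (b * b)) a at this
    rwa [CFC.sqrt_mul_self b] at this
  refine eq_of_mul_left_eq hinj ?_
  rw [← h3.eq, ← two_smul ℂ] at h
  simpa using h

end

/-! ### Parametrising the pairs by unitaries commuting with `b`. -/

section

variable {H K : Type*} [NormedAddCommGroup H] [InnerProductSpace ℂ H] [CompleteSpace H]
    [NormedAddCommGroup K] [InnerProductSpace ℂ K] [CompleteSpace K]

omit [CompleteSpace H] [CompleteSpace K] in
lemma HasSymmetricForm.eq_smul_one_add_block {T : H →L[ℂ] H} {lam : ℝ} {B : K →L[ℂ] K}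
    {W : H ≃ₗᵢ[ℂ] WithLp 2 (K × K)} (h : HasSymmetricForm T lam B W) :
    T = (((1 + lam) / 2 : ℝ) : ℂ) • (1 : H →L[ℂ] H) + block W B 0 0 (-B) := by
  rw [← sub_eq_iff_eq_add']
  refine block_ext (W := W) fun x ↦ ?_
  rw [h.form, apply_block]
  apply WithLp.ofLp_injective
  simp [directSum]
  rfl

open scoped ComplexOrder in
lemma HasSymmetricForm.exists_symbols {T : H →L[ℂ] H} {lam : ℝ} {B : K →L[ℂ] K}
    {W : H ≃ₗᵢ[ℂ] WithLp 2 (K × K)} (h : HasSymmetricForm T lam B W) (hl0 : lam ≠ 0)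
    (hl1 : lam ≠ -1) : 0 ≤ (2 : ℂ) • B ∧ Function.Injective ((2 : ℂ) • B) ∧
      ∃ u G : K →L[ℂ] K, IsSelfAdjoint u ∧ IsSelfAdjoint G ∧
      (2 * lam : ℂ) • (((2 : ℂ) • B) * u) =
        ((2 : ℂ) • B) * ((2 : ℂ) • B) + (lam ^ 2 - 1 : ℂ) • 1 ∧
      u * u + G * G = 1 ∧ Function.Injective G ∧
      (∀ z, Commute z ((2 : ℂ) • B) → Commute z u) ∧
      ∀ z, Commute z ((2 : ℂ) • B) → Commute z G := by
  have hsc : ∀ r : ℝ, algebraMap ℝ (K →L[ℂ] K) r = (2 : ℂ) • (((r / 2 : ℝ) : ℂ) • 1) := by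
    intro r
    rw [smul_smul, Algebra.algebraMap_eq_smul_one, ← Complex.coe_smul]
    congr 1
    push_cast
    ring
  have h2 : Function.Injective (fun x : K ↦ (2 : ℂ) • x) := smul_right_injective K two_ne_zero
  have h0 : (0 : ℂ) ≤ 2 := by exact_mod_cast (zero_le_two : (0 : ℝ) ≤ 2)
  have h2B : 0 ≤ (2 : ℂ) • B := by
    rw [nonneg_iff_isPositive]
    exact h.pos.smul_of_nonneg h0
  have hlow : (2 : ℂ) • B - algebraMap ℝ (K →L[ℂ] K) |1 - (|lam|)| =
      (2 : ℂ) • (B - ((|1 - (|lam|)| / 2 : ℝ) : ℂ) • 1) := by rw [hsc, smul_sub]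
  have hup : algebraMap ℝ (K →L[ℂ] K) (1 + |lam|) - (2 : ℂ) • B =
      (2 : ℂ) • ((((1 + |lam|) / 2 : ℝ) : ℂ) • 1 - B) := by rw [hsc, smul_sub]
  obtain ⟨hinj, u, G, hu, hG, hbu, huG, hGi, hcu, hcG⟩ := exists_pencil_symbols (b := (2 : ℂ) • B)
    hl0 hl1 h2B
    (by rw [le_def, hlow]; exact h.lower.1.smul_of_nonneg h0)
    (by rw [hlow]; exact h2.comp h.lower.2)
    (by rw [le_def, hup]; exact h.upper.1.smul_of_nonneg h0)
    (by rw [hup]; exact h2.comp h.upper.2)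
  refine ⟨h2B, hinj, u, G, hu, hG, ?_, huG, hGi, hcu, hcG⟩
  rw [← Complex.coe_smul, ← Complex.coe_smul] at hbu
  exact_mod_cast hbu

section

variable {W : H ≃ₗᵢ[ℂ] WithLp 2 (K × K)} {l : ℝ} {b u G : K →L[ℂ] K}

lemma unitary_mul_polar_identities (hG : IsSelfAdjoint G)
    (hcG : ∀ z, Commute z b → Commute z G) {w : K →L[ℂ] K} (hw : w ∈ unitary (K →L[ℂ] K)) (hwb : Commute w b) :
    Commute (w * G) b ∧ (w * G) * star (w * G) = G * G ∧ star (w * G) * (w * G) = G * G := by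
  have hbG : Commute b G := hcG b rfl
  obtain ⟨h1, h2⟩ := Unitary.mem_iff.mp hw
  refine ⟨hwb.mul_left hbG.symm, ?_, ?_⟩
  · rw [(hcG w hwb).eq, star_mul, hG.star_eq, mul_assoc, ← mul_assoc w, h2, one_mul]
  · rw [star_mul, hG.star_eq, mul_assoc, ← mul_assoc (star w), h1, one_mul]

lemma involution_block_and_sub {y : K →L[ℂ] K} (hb : IsSelfAdjoint b) (hu : IsSelfAdjoint u)
    (hbu : (2 * l : ℂ) • (b * u) = b * b + (l ^ 2 - 1 : ℂ) • 1)
    (hcu : ∀ z, Commute z b → Commute z u) (hyb : Commute y b)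
    (h1 : u * u + y * star y = 1) (h2 : u * u + star y * y = 1) :
    (IsSelfAdjoint (block W u y (star y) (-u)) ∧
      block W u y (star y) (-u) * block W u y (star y) (-u) = 1) ∧
    IsSelfAdjoint (block W b 0 0 (-b) - (l : ℂ) • block W u y (star y) (-u)) ∧
      (block W b 0 0 (-b) - (l : ℂ) • block W u y (star y) (-u)) *
      (block W b 0 0 (-b) - (l : ℂ) • block W u y (star y) (-u)) = 1 := by
  have hyb' : Commute (star y) b := by simpa [hb.star_eq] using hyb.star_star
  have hbu' : u * b = b * u := (hcu b rfl).eq.symm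
  refine ⟨⟨isSelfAdjoint_block hu, block_mul_self (hcu y hyb) (hcu _ hyb') h1 h2⟩, ?_⟩
  have hV : block W b 0 0 (-b) - (l : ℂ) • block W u y (star y) (-u) =
      block W (b - (l : ℂ) • u) (-(l : ℂ) • y) (star (-(l : ℂ) • y)) (-(b - (l : ℂ) • u)) := by
    rw [block_smul, block_sub, block_inj]
    refine ⟨rfl, ?_, ?_, ?_⟩
    · simp
    · simp
    · simp [add_comm, sub_eq_add_neg]
  have hp : IsSelfAdjoint (b - (l : ℂ) • u) := by
    rw [IsSelfAdjoint, star_sub, star_smul, hb.star_eq, hu.star_eq]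
    simp
  -- The equation for `u` is exactly `(b - lu)² = 1 - l²(1 - u²)`.
  have hsq : ∀ z : K →L[ℂ] K, u * u + z = 1 →
      (b - (l : ℂ) • u) * (b - (l : ℂ) • u) + ((l : ℂ) * l) • z = 1 := by
    intro z hz
    have hz' : z = 1 - u * u := eq_sub_of_add_eq' hz
    have hbb : b * b = (2 * l : ℂ) • (b * u) - (l ^ 2 - 1 : ℂ) • 1 := eq_sub_of_add_eq hbu.symm
    simp only [sub_mul, mul_sub, smul_mul_assoc, mul_smul_comm, hbu', hbb, hz']
    module
  rw [hV]
  refine ⟨isSelfAdjoint_block hp, block_mul_self ?_ ?_ ?_ ?_⟩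
  · exact (hyb.sub_right ((hcu y hyb).smul_right _)).smul_left _
  · rw [star_smul]
    exact (hyb'.sub_right ((hcu _ hyb').smul_right _)).smul_left _
  · rw [← hsq _ h1, star_smul, smul_mul_smul_comm]
    simp
  · rw [← hsq _ h2, star_smul, smul_mul_smul_comm]
    simp

lemma exists_block_of_involution (hl : l ≠ 0) (hb : 0 ≤ b) (hinj : Function.Injective b)
    (hbu : (2 * l : ℂ) • (b * u) = b * b + (l ^ 2 - 1 : ℂ) • 1)
    (hcu : ∀ z, Commute z b → Commute z u) {U : H →L[ℂ] H} (hU : IsSelfAdjoint U)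
    (hU2 : U * U = 1)
    (hV2 : (block W b 0 0 (-b) - (l : ℂ) • U) * (block W b 0 0 (-b) - (l : ℂ) • U) = 1) :
    ∃ y : K →L[ℂ] K, Commute y b ∧ u * u + y * star y = 1 ∧ u * u + star y * y = 1 ∧
      U = block W u y (star y) (-u) := by
  obtain ⟨x, y, z, t, rfl⟩ := exists_eq_block (W := W) U
  have hbu' : u * b = b * u := (hcu b rfl).eq.symm
  have hlc : (l : ℂ) ≠ 0 := by exact_mod_cast hl
  have hz : z = star y := by
    rw [IsSelfAdjoint, star_block, block_inj] at hU
    exact hU.2.2.1.symm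
  subst hz
  have hbb : b * b = (2 * l : ℂ) • (b * u) - (l ^ 2 - 1 : ℂ) • 1 := eq_sub_of_add_eq hbu.symm
  -- The expansion of `(S - lU)² = 1`, linear in `U` because `U² = 1`. Comparing its diagonal
  -- entries with the equation for `u` shows that `x - u` and `t + u` anticommute with `b`.
  have hexp : block W b 0 0 (-b) * block W b 0 0 (-b) - (l : ℂ) •
      (block W b 0 0 (-b) * block W x y (star y) t + block W x y (star y) t * block W b 0 0 (-b)) +
      ((l : ℂ) ^ 2 - 1) • block W 1 0 0 1 = block W 0 0 0 0 := by
    have h0 : block W 0 0 0 0 = (0 : H →L[ℂ] H) := by simp [block]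
    rw [h0, block_one]
    simp only [sub_mul, mul_sub, smul_mul_assoc, mul_smul_comm, hU2] at hV2
    rw [← sub_eq_zero] at hV2
    rw [← hV2]
    module
  simp only [block_mul, block_add, block_sub, block_smul, block_inj] at hexp
  obtain ⟨e1, e2, -, e4⟩ := hexp
  have hx : x = u := by
    rw [← sub_eq_zero]
    refine eq_zero_of_anticommute hb hinj (smul_right_injective _ hlc ?_)
    simp only [hbb, mul_zero, add_zero, zero_mul] at e1
    simp only [smul_zero, mul_sub, sub_mul, hbu']
    rw [← neg_eq_zero, ← e1]
    module
  have ht : t = -u := by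
    rw [eq_neg_iff_add_eq_zero]
    refine eq_zero_of_anticommute hb hinj (smul_right_injective _ hlc ?_)
    simp only [hbb, mul_zero, zero_add, zero_mul, neg_mul, mul_neg] at e4
    simp only [smul_zero, mul_add, add_mul, hbu']
    rw [← e4]
    module
  have hy : Commute y b := by
    simp only [mul_zero, zero_mul, add_zero, zero_add, mul_neg, smul_zero, neg_zero, zero_sub,
      neg_eq_zero, smul_eq_zero, hlc, false_or] at e2
    exact (eq_of_sub_eq_zero (by rw [sub_eq_add_neg]; exact e2)).symm
  subst hx ht
  refine ⟨y, hy, ?_, ?_, rfl⟩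
  · rw [block_mul, ← block_one (W := W), block_inj] at hU2
    exact hU2.1
  · rw [block_mul, ← block_one (W := W), block_inj] at hU2
    rw [← hU2.2.2.2, neg_mul_neg, add_comm]

end

theorem isConnected_pencilPairs {T : H →L[ℂ] H} {lam : ℝ} {B : K →L[ℂ] K}
    {W : H ≃ₗᵢ[ℂ] WithLp 2 (K × K)} (h : HasSymmetricForm T lam B W) (hl0 : lam ≠ 0)
    (hl1 : lam ≠ -1) : IsConnected (pencilPairs T lam) := by
  have hT := h.eq_smul_one_add_block
  obtain ⟨hb, hinj, u, G, hu, hG, hbu, huG, hGi, hcu, hcG⟩ := h.exists_symbols hl0 hl1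
  have hS : block W B 0 0 (-B) = (1 / 2 : ℂ) • block W ((2 : ℂ) • B) 0 0 (-((2 : ℂ) • B)) := by
    simp [block_smul, smul_smul]
  rw [hS] at hT
  set b := (2 : ℂ) • B
  have hbs : IsSelfAdjoint b := hb.isSelfAdjoint
  set S := block W b 0 0 (-b)
  have := connectedSpace_unitary_commutant hbs
  let y : unitary (commutant b) → K →L[ℂ] K := fun w ↦ (w : commutant b) * G
  have hy : ∀ w, Commute (y w) b ∧ y w * star (y w) = G * G ∧ star (y w) * y w = G * G := by
    intro w
    have hw := Unitary.mem_iff.mp w.2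
    exact unitary_mul_polar_identities hG hcG
      (Unitary.mem_iff.mpr ⟨congr(Subtype.val $(hw.1)), congr(Subtype.val $(hw.2))⟩)
      ((mem_commutant hbs).mp w.1.2)
  have hyc : Continuous y := by fun_prop
  let U : unitary (commutant b) → H →L[ℂ] H := fun w ↦ block W u (y w) (star (y w)) (-u)
  have hUc : Continuous U := continuous_block (by fun_prop) hyc hyc.star (by fun_prop)
  have hinv := fun w ↦ involution_block_and_sub (W := W) hbs hu hbu hcu (hy w).1
    ((hy w).2.1 ▸ huG) ((hy w).2.2 ▸ huG)
  let φ : unitary (commutant b) → Projections H × Projections H := fun w ↦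
    (⟨(1 / 2 : ℂ) • (1 + U w), isStarProjection_of_involution (hinv w).1.1 (hinv w).1.2⟩,
      ⟨(1 / 2 : ℂ) • (1 + (S - (lam : ℂ) • U w)),
        isStarProjection_of_involution (hinv w).2.1 (hinv w).2.2⟩)
  have hφ : Continuous φ := by
    refine Continuous.prodMk (Continuous.subtype_mk ?_ _) (Continuous.subtype_mk ?_ _) <;> fun_prop
  convert isConnected_range hφ
  ext ⟨⟨P, hP⟩, ⟨Q, hQ⟩⟩
  constructor
  · intro hPQ
    replace hPQ : T = (lam : ℂ) • P + Q := hPQ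
    have hQ' : (2 : ℂ) • Q - 1 = S - (lam : ℂ) • ((2 : ℂ) • P - 1) := by
      rw [← sub_eq_iff_eq_add'] at hPQ
      rw [← hPQ, hT]
      push_cast
      module
    have hP2 := involution_of_isStarProjection hP
    have hQ2 := (involution_of_isStarProjection hQ).2
    rw [hQ'] at hQ2
    obtain ⟨z, hzb, hz1, hz2, hPz⟩ :=
      exists_block_of_involution hl0 hb hinj hbu hcu hP2.1 hP2.2 hQ2
    obtain ⟨w, hw, hwz, hwb⟩ := exists_unitary_mul_eq_of_star_mul_self (y := z) (b := b) hG hGi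
      (add_left_cancel (hz2.trans huG.symm)) (add_left_cancel (hz1.trans huG.symm)) (hcG z hzb) hzb
      (hcG b rfl).symm
    obtain ⟨hw1, hw2⟩ := Unitary.mem_iff.mp hw
    let v : unitary (commutant b) := ⟨⟨w, (mem_commutant hbs).mpr hwb⟩,
      Unitary.mem_iff.mpr ⟨Subtype.ext hw1, Subtype.ext hw2⟩⟩
    have hUv : U v = (2 : ℂ) • P - 1 := by
      rw [hPz, ← hwz]
    refine ⟨v, Prod.ext (Subtype.ext ?_) (Subtype.ext ?_)⟩
    · change (1 / 2 : ℂ) • (1 + U v) = P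
      rw [hUv]
      module
    · change (1 / 2 : ℂ) • (1 + (S - (lam : ℂ) • U v)) = Q
      rw [hUv, ← hQ']
      module
  · rintro ⟨w, hw⟩
    obtain ⟨hw1, hw2⟩ := Prod.ext_iff.mp hw
    have e1 : (1 / 2 : ℂ) • (1 + U w) = P := congr(Subtype.val $hw1)
    have e2 : (1 / 2 : ℂ) • (1 + (S - (lam : ℂ) • U w)) = Q := congr(Subtype.val $hw2)
    change T = (lam : ℂ) • P + Q
    rw [← e1, ← e2, hT]
    push_cast
    module

end

end Pencil

theorem corollary2p4 {H K : Type*}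
    [NormedAddCommGroup H] [InnerProductSpace ℂ H] [CompleteSpace H]
    [NormedAddCommGroup K] [InnerProductSpace ℂ K] [CompleteSpace K]
    (T : H →L[ℂ] H) (hT : IsSelfAdjoint T)
    (lam : ℝ) (hlam_ne_neg_one : lam ≠ -1) (hlam_ne_zero : lam ≠ 0)
    (hgen : Pencil.InGenericPosition T lam)
    (B : K →L[ℂ] K) (W : H ≃ₗᵢ[ℂ] WithLp 2 (K × K))
    (hform : Pencil.HasSymmetricForm T lam B W) :
    IsConnected (Pencil.pencilPairs T lam) :=
  Pencil.isConnected_pencilPairs hform hlam_ne_zero hlam_ne_neg_one
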